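/- Let $f$ be a modular form of integer weight $k\ge 2$ for a congruence subgroup $\Gamma\subset \mathrm{SL}_2(\mathbb Z)$, let $N\ge 1$ be an integer with $\Gamma(N)\subset\Gamma$, and write $f(\tau)=\sum_{n\ge 0}a_n q^{n/N}$ with $q^{1/N}=e^{2\pi i\tau/N}$. Let $x=r/p\in\mathbb Q$ with $r\in\mathbb Z$, $p\in\mathbb Z_{>0}$ coprime. Let $a_0^{(x)}\in\mathbb C$ be the constant determined by $(f|_k\delta)(\tau)=a_0^{(x)}+O(q^{1/M})$ as $\operatorname{Im}\tau\to\infty$, for some $\delta=\begin{pmatrix} r & r'\\ p& p'\end{pmatrix}\in \mathrm{SL}_2(\mathbb Z)$ and some positive integer $M$, where $(f|_k\delta)(\tau)=(p\tau+p')^{-k}f(\delta\tau)$. Let $\widehat L_f(s;x)$ be the holomorphic function on $\mathbb C\smallsetminus\{0,k\}$ that continues $$-\left(\frac{N}{2\pi}\right)^{s} e^{-\pi i s/2}\,\Gamma(s)\sum_{n=1}^\infty \frac{a_n}{n^s}\,e^{2\pi i n x/N},$$ defined for $\operatorname{Re}(s)$ large, and let $S_f(x):=\widehat L_f(k-1;x)$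 be the generalized Dedekind sum. For $\operatorname{Im}\tau>0$ let $$\mathcal E_f(\tau):=\int_\tau^{i\infty}(f(z)-a_0)(\tau-z)^{k-2}\,dz$$ be the Eichler integral of $f$. All these objects are well defined, and $$\mathcal E_f(\tau)=\frac{a_0^{(x)}}{(k-1)p^k}\,\frac{1}{\tau-x}+S_f(x)+O(\tau-x)$$ as $\tau\to x$ non-tangentially, that is, within the sector $\{\tau : \operatorname{Im}\tau>0,\ |\operatorname{Re}\tau-x|\le C\operatorname{Im}\tau\}$ for every fixed $C>0$ (the implied constant may depend on $C$). In particular, $S_f(x)$ is the constant term of a radial limit of the Eichler integral: $$S_f(x)=\lim_{t\to 0^+}\left(\mathcal E_f(x+it)-\frac{a_0^{(x)}}{(k-1)p^k}\,\frac{1}{it}\right).$$ -/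

import Mathlib

open scoped MatrixGroups ModularForm

noncomputable section

/-- The coefficient `a_n` in the Fourier expansion `f(τ) = ∑_{n ≥ 0} a_n q^{n/N}`,
where `q^{1/N} = exp(2πiτ/N)`. -/
def modFourierCoeff (f : UpperHalfPlane → ℂ) (N n : ℕ) : ℂ :=
  (UpperHalfPlane.qExpansion (N : ℝ) f).coeff n

/-- The integrand `(f(z) - a_0) (τ - z)^(k-2)` of the Eichler integral, for `z` in the
upper half plane. -/
def eichlerIntegrand (f : UpperHalfPlane → ℂ) (N k : ℕ) (τ z : ℂ) : ℂ :=
  (f (UpperHalfPlane.ofComplex z) - modFourierCoeff f N 0) * (τ - z) ^ (k - 2)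

/-- The Eichler integral `∫_τ^{i∞} (f(z) - a_0) (τ - z)^(k-2) dz`, for `τ` in the upper half
plane, taken along the vertical half-line `z = τ + it`, `t > 0`, with `dz = i dt`. -/
def eichlerIntegral (f : UpperHalfPlane → ℂ) (N k : ℕ) (τ : ℂ) : ℂ :=
  ∫ t in Set.Ioi (0 : ℝ), eichlerIntegrand f N k τ (τ + t * Complex.I) * Complex.I

/-- `a` is the constant term at the cusp `x = r/p` (in lowest terms, `p > 0`):
`(f|_k δ)(τ) = a + O(q^{1/M})` as `Im τ → ∞`, for some `δ ∈ SL₂(ℤ)` with first column `(r, p)`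
and some positive integer `M`. -/
def IsCuspConstant (f : UpperHalfPlane → ℂ) (k : ℕ) (x : ℚ) (a : ℂ) : Prop :=
  ∃ δ : SL(2, ℤ), δ 0 0 = x.num ∧ δ 1 0 = x.den ∧ ∃ M : ℕ, 0 < M ∧
    (fun τ : UpperHalfPlane => (f ∣[(k : ℤ)] δ) τ - a) =O[UpperHalfPlane.atImInfty]
      fun τ : UpperHalfPlane => Function.Periodic.qParam (M : ℝ) (τ : ℂ)

/-- The constant term `a_0^{(x)}` of `f` at the cusp `x`. -/
def cuspConstant (f : UpperHalfPlane → ℂ) (k : ℕ) (x : ℚ) : ℂ :=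
  Classical.epsilon (IsCuspConstant f k x)

/-- The coefficients `a_n e(nx/N)` of the twisted Dirichlet series, with `e(z) = exp(2πiz)`. -/
def twistedCoeff (f : UpperHalfPlane → ℂ) (N : ℕ) (x : ℚ) (n : ℕ) : ℂ :=
  modFourierCoeff f N n * Complex.exp (2 * Real.pi * Complex.I * (n * x / N))

/-- The twisted L-series `L_f(s; x) = N^s ∑_{n ≥ 1} a_n e(nx/N) n^{-s}`, where it converges
absolutely. (`LSeries` leaves out the term `n = 0`.) -/
def twistedLSeries (f : UpperHalfPlane → ℂ) (N : ℕ) (x : ℚ) (s : ℂ) : ℂ :=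
  (N : ℂ) ^ s * LSeries (twistedCoeff f N x) s

/-- `F` is the completed twisted L-function: it is holomorphic on `ℂ ∖ {0, k}` and continues
`-(2π)^{-s} e(-s/4) Γ(s) L_f(s; x)`, which is given by an absolutely convergent Dirichlet series
on some right half plane. -/
def IsCompletedTwistedL (f : UpperHalfPlane → ℂ) (N k : ℕ) (x : ℚ) (F : ℂ → ℂ) : Prop :=
  DifferentiableOn ℂ F {0, (k : ℂ)}ᶜ ∧
  LSeries.abscissaOfAbsConv (twistedCoeff f N x) < ⊤ ∧
  ∀ s : ℂ, (k : ℝ) < s.re → LSeries.abscissaOfAbsConv (twistedCoeff f N x) < s.re →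
    F s = -(2 * Real.pi : ℂ) ^ (-s) * Complex.exp (2 * Real.pi * Complex.I * (-s / 4)) *
      Complex.Gamma s * twistedLSeries f N x s

/-- The completed twisted L-function `s ↦ L̂_f(s; x)`. -/
def completedTwistedL (f : UpperHalfPlane → ℂ) (N k : ℕ) (x : ℚ) : ℂ → ℂ :=
  Classical.epsilon (IsCompletedTwistedL f N k x)

/-- The generalized Dedekind sum `S_f(x) = L̂_f(k - 1; x)`. -/
def generalizedDedekindSum (f : UpperHalfPlane → ℂ) (N k : ℕ) (x : ℚ) : ℂ :=
  completedTwistedL f N k x ((k : ℂ) - 1)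

/-- The polar term `a_0^{(x)} / ((k-1) p^k (τ - x))`, where `p` is the denominator of `x`. -/
def eichlerPole (f : UpperHalfPlane → ℂ) (k : ℕ) (x : ℚ) (τ : ℂ) : ℂ :=
  cuspConstant f k x / (((k : ℂ) - 1) * (x.den : ℂ) ^ k) * (1 / (τ - (x : ℂ)))

/-- The sector `|Re τ - x| ≤ C Im τ` of the upper half plane with vertex `x`. -/
def stolzSector (x : ℚ) (C : ℝ) : Set ℂ :=
  {τ | 0 < τ.im ∧ |τ.re - (x : ℝ)| ≤ C * τ.im}

end

/-! Translate the cusp to the origin: put `ψ ζ = f (x + ζ)`, `ζ = τ - x` and `n = k - 2`. Along `z =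
τ + it` the factor `τ - z` is `-it`, so the Eichler integral is `∫_0^∞ (ψ(ζ + it) - a)(-it)^n i dt`,
and formally its value at `ζ = 0` is a Mellin transform of `ψ(it) - a` at `n + 1 = k - 1`. That
integral diverges at `t = 0` in general, since `ψ z` behaves like `c / z^k` there, with `c = (-1)^k
p^{-k} a_0^{(x)}`.

The remedy is the one used to continue the L-function: cut at `t = 1` and subtract `c / z^k` on `(0,
1]`. The regularized integrals are Lipschitz in `ζ` at `0` within a sector: `ψ - c / z^k` is
exponentially small at the cusp, and Cauchy estimates bound its derivative
(`exists_lipschitz_sector`, `exists_lipschitz_top`). Their value at `0` is the entire function `Λ₀`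
of the `WeakFEPair` attached to `ψ` (`mellin_f_modif_eq`).

The subtracted terms integrate in closed form (`eichler_eq`). Expanding them at `ζ = 0` gives the
pole, together with exactly the two constants by which `Λ` differs from `Λ₀` at `k - 1`; this is
`eichler_isBigO`. Finally `Λ` is the twisted L-function up to an exponential factor
(`isCompletedTwistedL_Λ`), and the identity theorem removes the choice in the definition of the
completed L-function. -/

/-- `ψ z → a` exponentially fast as `Im z → ∞`, uniformly in `Re z`. -/
def ExpDecaysTo (ψ : ℂ → ℂ) (a : ℂ) : Prop :=
  ∃ A K κ : ℝ, 0 < κ ∧ ∀ z : ℂ, 0 < z.im → A ≤ z.im → ‖ψ z - a‖ ≤ K * Real.exp (-κ * z.im)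

/-- The inversion `w ↦ (-1/w)^k ψ(-1/w)`, which moves the cusp `0` to `i∞`. -/
noncomputable def invertCusp (ψ : ℂ → ℂ) (k : ℕ) (w : ℂ) : ℂ := ψ (-1 / w) * (-1 / w) ^ k

/-- `ψ` is holomorphic on the upper half plane, with constant term `a` at `i∞` and with constant
term `c` at `0` in weight `k`. -/
structure HasCuspConstants (ψ : ℂ → ℂ) (a c : ℂ) (k : ℕ) : Prop where
  differentiableOn : DifferentiableOn ℂ ψ {z | 0 < z.im}
  top : ExpDecaysTo ψ a
  zero : ExpDecaysTo (invertCusp ψ k) c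

/-! ### Bounds and Lipschitz estimates near the cusps `0` and `i∞` -/

namespace HasCuspConstants

open Complex Set Filter Topology MeasureTheory Asymptotics

variable {ψ : ℂ → ℂ} {a c : ℂ} {k : ℕ}

lemma isOpen_im_pos : IsOpen {z : ℂ | 0 < z.im} := isOpen_lt continuous_const continuous_im

lemma differentiableAt (h : HasCuspConstants ψ a c k) {z : ℂ} (hz : 0 < z.im) :
    DifferentiableAt ℂ ψ z :=
  (h.differentiableOn z hz).differentiableAt (isOpen_im_pos.mem_nhds hz)

lemma ne_zero_of_im_pos {z : ℂ} (hz : 0 < z.im) : z ≠ 0 := by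
  rintro rfl; simp at hz

lemma im_neg_one_div (z : ℂ) : (-1 / z).im = z.im / ‖z‖ ^ 2 := by
  rw [neg_div, one_div, neg_im, inv_im, normSq_eq_norm_sq]; ring

/-- Since `z ↦ -1/z` is an involution, the error at the cusp `0` becomes the error of the inverted
function at `i∞`, where decay is known. -/
lemma norm_sub_div_pow {z : ℂ} (hz : 0 < z.im) :
    ‖ψ z - c / z ^ k‖ = ‖invertCusp ψ k (-1 / z) - c‖ / ‖z‖ ^ k := by
  have hz0 := ne_zero_of_im_pos hz
  have e : -1 / (-1 / z) = z := by field_simp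
  rw [invertCusp, e, ← norm_pow, ← norm_div]
  congr 1
  have : z ^ k ≠ 0 := pow_ne_zero _ hz0
  field_simp

lemma exp_neg_le_factorial_div (n : ℕ) {y : ℝ} (hy : 0 < y) :
    Real.exp (-y) ≤ n.factorial / y ^ n := by
  have h := Real.pow_div_factorial_le_exp y hy.le n
  rw [Real.exp_neg, inv_eq_one_div, div_le_div_iff₀ (Real.exp_pos _) (by positivity)]
  rw [div_le_iff₀ (by positivity)] at h
  linarith

/-- In a sector with vertex `0`, the function `ψ` differs from `c / z ^ k` by `O(z)`. -/
lemma exists_norm_sub_div_pow_le (h : HasCuspConstants ψ a c k) {C : ℝ} (hC : 0 < C) (T : ℝ) :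
    ∃ K, 0 ≤ K ∧ ∀ z : ℂ, 0 < z.im → |z.re| ≤ C * z.im → z.im ≤ T →
      ‖ψ z - c / z ^ k‖ ≤ K * ‖z‖ := by
  obtain ⟨A, K, κ, hκ, hA⟩ := h.zero
  have hnorm : ∀ z : ℂ, 0 < z.im → |z.re| ≤ C * z.im → ‖z‖ ≤ (1 + C) * z.im := fun z h1 h2 ↦ by
    have := Complex.norm_le_abs_re_add_abs_im z
    rw [abs_of_pos h1] at this
    linarith
  -- In the sector `Im(-1/z) ≥ 1/((1 + C)‖z‖)`, so height below `y₀` forces `Im(-1/z) ≥ A`, where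
  -- the decay at the cusp applies. The part above `y₀` is compact.
  set y₀ : ℝ := 1 / ((1 + C) ^ 2 * max A 1) with hy₀_def
  have hy₀ : 0 < y₀ := by positivity
  -- compact part
  set S : Set ℂ := {z | |z.re| ≤ C * z.im} ∩ ({z | y₀ ≤ z.im} ∩ {z | z.im ≤ T}) with hS
  have hScomp : IsCompact S := by
    refine Metric.isCompact_of_isClosed_isBounded ?_ ?_
    · refine IsClosed.inter (isClosed_le (by fun_prop) (by fun_prop)) (IsClosed.inter
        (isClosed_le (by fun_prop) (by fun_prop)) (isClosed_le (by fun_prop) (by fun_prop)))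
    · refine (Metric.isBounded_iff_subset_closedBall 0).mpr ⟨(1 + C) * T, fun z hz ↦ ?_⟩
      have h1 : 0 < z.im := hy₀.trans_le hz.2.1
      rw [mem_closedBall_zero_iff]
      refine (hnorm z h1 hz.1).trans ?_
      gcongr
      exact hz.2.2
  obtain ⟨M, hM⟩ := hScomp.exists_bound_of_continuousOn (f := fun z ↦ ψ z - c / z ^ k) (by
    intro z hz
    have h1 : 0 < z.im := hy₀.trans_le hz.2.1
    exact (((h.differentiableAt h1).sub (by
      have := pow_ne_zero k (ne_zero_of_im_pos h1)
      fun_prop (disch := assumption))).continuousAt).continuousWithinAt)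
  -- The exponential is bounded by the power `k + 1` of `‖z‖`: `k` powers absorb the division by
  -- `‖z‖ ^ k`, and one remains.
  set K₁ : ℝ := |K| * ((k + 1).factorial / (κ / (1 + C)) ^ (k + 1))
  refine ⟨max (|M| / y₀) K₁, le_max_of_le_left (by positivity), fun z hz hzC hzT ↦ ?_⟩
  have hzn : 0 < ‖z‖ := norm_pos_iff.mpr (ne_zero_of_im_pos hz)
  rcases le_or_gt y₀ z.im with hzy₀ | hzy₀
  · have h1 := hM z ⟨hzC, hzy₀, hzT⟩
    have h2 : y₀ ≤ ‖z‖ := hzy₀.trans ((le_abs_self _).trans (abs_im_le_norm z))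
    calc _ ≤ M := h1
      _ ≤ |M| := le_abs_self M
      _ = |M| / y₀ * y₀ := by field_simp
      _ ≤ max (|M| / y₀) K₁ * ‖z‖ := by gcongr; exact le_max_left _ _
  · have h1 : 1 / ((1 + C) * ‖z‖) ≤ (-1 / z).im := by
      rw [im_neg_one_div, div_le_div_iff₀ (by positivity) (by positivity)]
      nlinarith [hnorm z hz hzC]
    have h2 : A ≤ (-1 / z).im := by
      refine le_trans ?_ h1
      rw [le_div_iff₀ (by positivity)]
      have : z.im * ((1 + C) ^ 2 * max A 1) ≤ 1 := by
        rw [hy₀_def, lt_div_iff₀ (by positivity)] at hzy₀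
        exact hzy₀.le
      have hn := hnorm z hz hzC
      calc A * ((1 + C) * ‖z‖) ≤ max A 1 * ((1 + C) * ((1 + C) * z.im)) := by
            gcongr
            exact le_max_left _ _
        _ = z.im * ((1 + C) ^ 2 * max A 1) := by ring
        _ ≤ 1 := this
    have h3 := hA _ (lt_of_lt_of_le (by positivity) h1) h2
    rw [norm_sub_div_pow hz, div_le_iff₀ (by positivity)]
    calc _ ≤ K * Real.exp (-κ * (-1 / z).im) := h3
      _ ≤ |K| * Real.exp (-(κ / (1 + C) / ‖z‖)) := by
          gcongr
          · exact le_abs_self K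
          · rw [neg_mul, neg_le_neg_iff]
            calc κ / (1 + C) / ‖z‖ = κ * (1 / ((1 + C) * ‖z‖)) := by field_simp
              _ ≤ _ := by gcongr
      _ ≤ |K| * ((k + 1).factorial / (κ / (1 + C) / ‖z‖) ^ (k + 1)) := by
          gcongr
          exact exp_neg_le_factorial_div _ (by positivity)
      _ = K₁ * ‖z‖ ^ (k + 1) := by
          simp only [K₁, div_pow]
          field_simp
      _ ≤ max (|M| / y₀) K₁ * ‖z‖ * ‖z‖ ^ k := by
          rw [mul_assoc _ ‖z‖, ← pow_succ']
          gcongr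
          exact le_max_right _ _

/-- In a sector with vertex `0`, the function `ψ z - c / z ^ k` is Lipschitz along vertical
translates. -/
lemma exists_lipschitz_sector (h : HasCuspConstants ψ a c k) {C : ℝ} (hC : 0 < C) :
    ∃ K, 0 ≤ K ∧ ∀ ζ : ℂ, 0 < ζ.im → |ζ.re| ≤ C * ζ.im → ζ.im ≤ 1 → ∀ t : ℝ, 0 < t → t ≤ 1 →
      ‖(ψ (ζ + t * I) - c / (ζ + t * I) ^ k) - (ψ (t * I) - c / (t * I) ^ k)‖ ≤ K * ‖ζ‖ := by
  -- A disc of radius `Im z / 2` about a point of the sector of slope `C` and height at most `2`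
  -- stays in the sector of slope `2C + 1` and height at most `3`.
  obtain ⟨K, hK, hKb⟩ := h.exists_norm_sub_div_pow_le (C := 2 * C + 1) (by positivity) 3
  set R : ℂ → ℂ := fun z ↦ ψ z - c / z ^ k with hR
  have hRd : ∀ z : ℂ, 0 < z.im → DifferentiableAt ℂ R z := fun z hz ↦ by
    refine (h.differentiableAt hz).sub ?_
    have := pow_ne_zero k (ne_zero_of_im_pos hz)
    fun_prop (disch := assumption)
  set S : Set ℂ := {z | 0 < z.im ∧ |z.re| ≤ C * z.im ∧ z.im ≤ 2} with hS
  have hSconv : Convex ℝ S := by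
    intro u hu v hv α β hα hβ hαβ
    obtain ⟨u1, u2, u3⟩ := hu
    obtain ⟨v1, v2, v3⟩ := hv
    rw [abs_le] at u2 v2
    have e : (α • u + β • v).im = α * u.im + β * v.im := by simp
    have e' : (α • u + β • v).re = α * u.re + β * v.re := by simp
    refine ⟨?_, ?_, ?_⟩
    · rw [e]
      rcases hα.eq_or_lt with rfl | hα'
      · have : β = 1 := by linarith
        simp [this, v1]
      · have := mul_pos hα' u1
        have := mul_nonneg hβ v1.le
        linarith
    · rw [e, e', abs_le]
      constructor <;> nlinarith
    · rw [e]; nlinarith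
  -- Cauchy's estimate: `R` is `O(Im z)` on a circle of radius proportional to `Im z`, so the
  -- quotient is bounded uniformly up to the vertex.
  have hder : ∀ z ∈ S, ‖deriv R z‖ ≤ 6 * K * (2 * C + 2) := by
    rintro z ⟨z1, z2, z3⟩
    have hsph : ∀ w : ℂ, ‖w - z‖ ≤ z.im / 2 →
        0 < w.im ∧ z.im / 2 ≤ w.im ∧ w.im ≤ 3 / 2 * z.im ∧ |w.re| ≤ (2 * C + 1) * w.im := by
      intro w hw
      have h1 := (abs_im_le_norm (w - z)).trans hw
      have h2 := (abs_re_le_norm (w - z)).trans hw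
      rw [sub_im, abs_le] at h1
      rw [sub_re, abs_le] at h2
      rw [abs_le] at z2 ⊢
      refine ⟨by linarith, by linarith, by linarith, ?_, ?_⟩ <;> nlinarith
    have hcl : closure (Metric.ball z (z.im / 2)) ⊆ Metric.closedBall z (z.im / 2) :=
      Metric.closure_ball_subset_closedBall
    have hd : DiffContOnCl ℂ R (Metric.ball z (z.im / 2)) := by
      refine DifferentiableOn.diffContOnCl fun w hw ↦ ?_
      have := hcl hw
      rw [mem_closedBall_iff_norm] at this
      exact (hRd w (hsph w this).1).differentiableWithinAt
    refine (norm_deriv_le_of_forall_mem_sphere_norm_le (C := 3 * K * (2 * C + 2) * z.im)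
      (by positivity) hd fun w hw ↦ ?_).trans (le_of_eq (by field_simp; ring))
    rw [mem_sphere_iff_norm] at hw
    obtain ⟨w1, w2, w3, w4⟩ := hsph w hw.le
    refine (hKb w w1 w4 (by linarith)).trans ?_
    have := Complex.norm_le_abs_re_add_abs_im w
    rw [abs_of_pos w1] at this
    have : ‖w‖ ≤ (2 * C + 2) * (3 * z.im) := by
      have : ‖w‖ ≤ (2 * C + 2) * w.im := by linarith
      refine this.trans ?_
      gcongr
      linarith
    calc K * ‖w‖ ≤ K * ((2 * C + 2) * (3 * z.im)) := by gcongr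
      _ = _ := by ring
  refine ⟨6 * K * (2 * C + 2), by positivity, fun ζ h1 h2 h3 t ht ht1 ↦ ?_⟩
  have := hSconv.norm_image_sub_le_of_norm_deriv_le (f := R) (x := t * I) (y := ζ + t * I)
    (fun z hz ↦ hRd z hz.1) hder (by simp [hS, ht]; constructor; positivity; linarith)
    (by
      have : |ζ.re| ≤ C * (ζ.im + t) := h2.trans (by gcongr; linarith)
      simp [hS]
      exact ⟨by positivity, this, by linarith⟩)
  simpa using this

/-- Near the vertical half-line over `0`, `ψ - a` is Lipschitz with exponentially decaying
constant. -/
lemma exists_lipschitz_top (h : HasCuspConstants ψ a c k) :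
    ∃ K κ : ℝ, 0 ≤ K ∧ 0 < κ ∧ ∀ ζ : ℂ, 0 < ζ.im → ‖ζ‖ ≤ 1 → ∀ t : ℝ, 1 ≤ t →
      ‖(ψ (ζ + t * I) - a) - (ψ (t * I) - a)‖ ≤ K * Real.exp (-κ * t) * ‖ζ‖ := by
  obtain ⟨A, K, κ, hκ, hA⟩ := h.top
  set S : Set ℂ := {z | |z.re| ≤ 2} ∩ ({z | 1 / 2 ≤ z.im} ∩ {z | z.im ≤ A}) with hS
  have hScomp : IsCompact S := by
    refine Metric.isCompact_of_isClosed_isBounded ?_ ?_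
    · refine IsClosed.inter (isClosed_le (by fun_prop) (by fun_prop)) (IsClosed.inter
        (isClosed_le (by fun_prop) (by fun_prop)) (isClosed_le (by fun_prop) (by fun_prop)))
    · refine (Metric.isBounded_iff_subset_closedBall 0).mpr ⟨2 + A, fun z hz ↦ ?_⟩
      obtain ⟨z1, z2, z3⟩ := hz
      rw [mem_ofPred_eq] at z1 z2 z3
      rw [mem_closedBall_zero_iff]
      have := Complex.norm_le_abs_re_add_abs_im z
      rw [abs_of_pos (show 0 < z.im by linarith)] at this
      linarith
  obtain ⟨M, hM⟩ := hScomp.exists_bound_of_continuousOn (f := fun z ↦ ψ z - a) (by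
    intro z hz
    have h1 : 0 < z.im := one_half_pos.trans_le hz.2.1
    exact (((h.differentiableAt h1).sub_const a).continuousAt).continuousWithinAt)
  -- The factor `exp (κ * A)` lets the compact bound `M` be written as an exponential bound for
  -- heights below `A`.
  set K₁ := max |K| (|M| * Real.exp (κ * A)) with hK₁
  have hK₁0 : 0 ≤ K₁ := le_max_of_le_left (abs_nonneg _)
  have hb : ∀ z : ℂ, |z.re| ≤ 2 → 1 / 2 ≤ z.im → ‖ψ z - a‖ ≤ K₁ * Real.exp (-κ * z.im) := by
    intro z z1 z2
    rcases le_total A z.im with hz | hz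
    · refine (hA z (by linarith) hz).trans ?_
      gcongr
      exact (le_abs_self K).trans (le_max_left _ _)
    · calc _ ≤ M := hM z ⟨z1, z2, hz⟩
        _ ≤ |M| := le_abs_self M
        _ ≤ |M| * Real.exp (κ * A + -κ * z.im) := by
            refine le_mul_of_one_le_right (abs_nonneg _) (Real.one_le_exp ?_)
            nlinarith
        _ = |M| * Real.exp (κ * A) * Real.exp (-κ * z.im) := by rw [Real.exp_add]; ring
        _ ≤ _ := by gcongr; exact le_max_right _ _
  refine ⟨2 * K₁ * Real.exp κ, κ, by positivity, hκ, fun ζ h1 h2 t ht ↦ ?_⟩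
  set U : Set ℂ := {z | |z.re| ≤ 1 ∧ t ≤ z.im} with hU
  have hUconv : Convex ℝ U := by
    intro u hu v hv α β hα hβ hαβ
    obtain ⟨u1, u2⟩ := hu
    obtain ⟨v1, v2⟩ := hv
    rw [abs_le] at u1 v1
    have e : (α • u + β • v).im = α * u.im + β * v.im := by simp
    have e' : (α • u + β • v).re = α * u.re + β * v.re := by simp
    refine ⟨?_, ?_⟩
    · rw [e', abs_le]
      constructor <;> nlinarith
    · rw [e]; nlinarith
  have hder : ∀ z ∈ U, ‖deriv (fun z ↦ ψ z - a) z‖ ≤ 2 * K₁ * Real.exp κ * Real.exp (-κ * t) := by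
    rintro z ⟨z1, z2⟩
    have hsph : ∀ w : ℂ, ‖w - z‖ ≤ 1 / 2 → |w.re| ≤ 2 ∧ z.im - 1 / 2 ≤ w.im := by
      intro w hw
      have h1 := (abs_im_le_norm (w - z)).trans hw
      have h2 := (abs_re_le_norm (w - z)).trans hw
      rw [sub_im, abs_le] at h1
      rw [sub_re, abs_le] at h2
      rw [abs_le] at z1 ⊢
      refine ⟨⟨?_, ?_⟩, ?_⟩ <;> linarith
    have hd : DiffContOnCl ℂ (fun z ↦ ψ z - a) (Metric.ball z (1 / 2)) := by
      refine DifferentiableOn.diffContOnCl fun w hw ↦ ?_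
      have := Metric.closure_ball_subset_closedBall hw
      rw [mem_closedBall_iff_norm] at this
      exact ((h.differentiableAt (by linarith [(hsph w this).2])).sub_const a).differentiableWithinAt
    refine (norm_deriv_le_of_forall_mem_sphere_norm_le
      (C := K₁ * Real.exp κ * Real.exp (-κ * t))
      (by norm_num) hd fun w hw ↦ ?_).trans (le_of_eq (by ring))
    rw [mem_sphere_iff_norm] at hw
    obtain ⟨w1, w2⟩ := hsph w hw.le
    refine (hb w w1 (by linarith)).trans ?_
    rw [mul_assoc, ← Real.exp_add]
    gcongr
    nlinarith
  have := hUconv.norm_image_sub_le_of_norm_deriv_le (f := fun z ↦ ψ z - a) (x := t * I)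
    (y := ζ + t * I)
    (fun z hz ↦ (h.differentiableAt (by linarith [hz.2])).sub_const a) hder (by simp [hU])
    (by
      simp only [hU, mem_ofPred_eq, add_re, mul_re, ofReal_re, I_re, mul_zero, ofReal_im, I_im,
        mul_one, sub_self, add_zero, add_im, mul_im]
      exact ⟨(abs_re_le_norm ζ).trans h2, by linarith⟩)
  simpa using this

end HasCuspConstants

/-! ### Mellin transform and expansion of the Eichler integral -/

namespace HasCuspConstants

open Complex Set Filter Topology MeasureTheory Asymptotics

variable {ψ : ℂ → ℂ} {a c : ℂ} {k n : ℕ}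

lemma _root_.ExpDecaysTo.isBigO_exp (h : ExpDecaysTo ψ a) (ζ : ℂ) :
    ∃ κ : ℝ, 0 < κ ∧
      (fun t : ℝ ↦ ψ (ζ + t * I) - a) =O[atTop] fun t : ℝ ↦ Real.exp (-κ * t) := by
  obtain ⟨A, K, κ, hκ, hA⟩ := h
  refine ⟨κ, hκ, IsBigO.of_bound (K * Real.exp (-κ * ζ.im)) ?_⟩
  filter_upwards [eventually_gt_atTop (-ζ.im), eventually_ge_atTop (A - ζ.im)] with t h1 h2
  refine (hA _ (by simp; linarith) (by simp; linarith)).trans (le_of_eq ?_)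
  rw [Real.norm_of_nonneg (Real.exp_pos _).le, mul_assoc, ← Real.exp_add]
  simp
  ring_nf
  simp

lemma _root_.ExpDecaysTo.isBigO_rpow (h : ExpDecaysTo ψ a) (r : ℝ) :
    (fun t : ℝ ↦ ψ (t * I) - a) =O[atTop] fun t : ℝ ↦ t ^ r := by
  obtain ⟨κ, hκ, hO⟩ := h.isBigO_exp 0
  simpa using hO.trans (isLittleO_exp_neg_mul_rpow_atTop hκ r).isBigO

lemma continuousOn_vertical (h : HasCuspConstants ψ a c k) {ζ : ℂ} {s : Set ℝ}
    (hs : ∀ t ∈ s, 0 < ζ.im + t) : ContinuousOn (fun t : ℝ ↦ ψ (ζ + t * I)) s := fun t ht ↦ by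
  have h1 : ContinuousAt ψ (ζ + t * I) :=
    (h.differentiableAt (by simpa using hs t ht)).continuousAt
  exact (ContinuousAt.comp (f := fun t : ℝ ↦ ζ + t * I) h1 (by fun_prop)).continuousWithinAt

lemma continuousOn_invertCusp (h : HasCuspConstants ψ a c k) :
    ContinuousOn (fun t : ℝ ↦ invertCusp ψ k (t * I)) (Ioi 0) := by
  intro t (ht : 0 < t)
  have h0 : (t * I : ℂ) ≠ 0 := by simp [ht.ne']
  have h1 : ContinuousAt ψ (-1 / (t * I)) := by
    refine (h.differentiableAt ?_).continuousAt
    rw [im_neg_one_div]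
    simp
    positivity
  refine ContinuousAt.continuousWithinAt (ContinuousAt.mul
    (ContinuousAt.comp (f := fun t : ℝ ↦ -1 / (t * I)) h1 ?_) ?_) <;> fun_prop (disch := assumption)

/-- The pair of functions on the positive half-line, interchanged by inversion, whose Mellin
transform is the completed `L`-function. -/
noncomputable def weakFEPair (h : HasCuspConstants ψ a c k) (hk : 0 < k) : WeakFEPair ℂ where
  f t := ψ (t * I)
  g t := invertCusp ψ k (t * I)
  k := k
  ε := (I ^ k)⁻¹
  f₀ := a
  g₀ := c
  hf_int := ContinuousOn.locallyIntegrableOn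
    (by simpa using h.continuousOn_vertical (ζ := 0) (s := Ioi 0) (by simp)) measurableSet_Ioi
  hg_int := ContinuousOn.locallyIntegrableOn h.continuousOn_invertCusp measurableSet_Ioi
  hk := mod_cast hk
  hε := inv_ne_zero (pow_ne_zero _ I_ne_zero)
  h_feq t ht := by
    have ht' : (t : ℂ) ≠ 0 := by exact_mod_cast (ne_of_gt ht)
    have e : -1 / ((t : ℂ) * I) = 1 / t * I := by
      field_simp
      simp
    have : (I : ℂ) ^ k ≠ 0 := pow_ne_zero _ I_ne_zero
    rw [invertCusp, e, Real.rpow_natCast, smul_eq_mul, mul_pow, div_pow, one_pow]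
    push_cast
    field_simp
  hf_top r := h.top.isBigO_rpow r
  hg_top r := h.zero.isBigO_rpow r

lemma integrableOn_top (h : HasCuspConstants ψ a c k) (n : ℕ) {ζ : ℂ} {b : ℝ}
    (hζ : 0 < ζ.im + b) :
    IntegrableOn (fun t : ℝ ↦ (ψ (ζ + t * I) - a) * (-(t * I)) ^ n * I) (Ioi b) := by
  obtain ⟨κ, hκ, hO⟩ := h.top.isBigO_exp ζ
  have hcont : ContinuousOn (fun t : ℝ ↦ (ψ (ζ + t * I) - a) * (-(t * I)) ^ n * I) (Ici b) := by
    have := h.continuousOn_vertical (ζ := ζ) (s := Ici b) (fun t (ht : b ≤ t) ↦ by linarith)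
    exact ((this.sub continuousOn_const).mul (by fun_prop)).mul continuousOn_const
  refine IntegrableOn.mono_set (LocallyIntegrableOn.integrableOn_of_isBigO_atTop
    (g := fun t ↦ Real.exp (-(κ / 2) * t)) (hcont.locallyIntegrableOn measurableSet_Ici) ?_
    ⟨Ioi 0, Ioi_mem_atTop 0, exp_neg_integrableOn_Ioi 0 (by positivity)⟩) Ioi_subset_Ici_self
  have h1 : (fun t : ℝ ↦ (-(t * I) : ℂ) ^ n * I) =O[atTop] fun t : ℝ ↦ Real.exp (κ / 2 * t) := by
    refine IsBigO.trans (IsBigO.of_bound 1 (Eventually.of_forall fun t ↦ ?_))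
      (isLittleO_pow_exp_pos_mul_atTop (k := n) (b := κ / 2) (by positivity)).isBigO
    simp
  refine ((hO.mul h1).congr (fun t ↦ by ring) fun t ↦ ?_)
  rw [← Real.exp_add]
  ring_nf

/-- The modified function of a `WeakFEPair` already subtracts `c / z^k` on `(0, 1)` and `a` on `(1,
∞)`, so its Mellin integral is the regularized Eichler integral at `ζ = 0`. Its integrability on
`(0, 1]` comes for free from Mellin convergence. -/
lemma mellin_f_modif_eq (h : HasCuspConstants ψ a c (n + 2)) :
    IntegrableOn (fun t : ℝ ↦ (ψ (t * I) - c / (t * I) ^ (n + 2)) * (-(t * I)) ^ n * I)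
      (Ioc 0 1) ∧
    (-I) ^ n * I * (h.weakFEPair (by simp)).Λ₀ (n + 1) =
      (∫ t : ℝ in Ioc 0 1, (ψ (t * I) - c / (t * I) ^ (n + 2)) * (-(t * I)) ^ n * I) +
      ∫ t : ℝ in Ioi 1, (ψ (t * I) - a) * (-(t * I)) ^ n * I := by
  set P := h.weakFEPair (by simp)
  have hc : MellinConvergent P.f_modif (n + 1) :=
    (P.isStrongFEPair_toStrongFEPair.hasMellin (n + 1)).1
  have hc' : IntegrableOn (fun t : ℝ ↦ (-I) ^ n * I * ((t : ℂ) ^ n * P.f_modif t)) (Ioi 0) := by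
    refine Integrable.const_mul ?_ _
    simpa [MellinConvergent, IntegrableOn] using hc
  have e0 : EqOn (fun t : ℝ ↦ (-I) ^ n * I * ((t : ℂ) ^ n * P.f_modif t))
      (fun t : ℝ ↦ (ψ (t * I) - c / (t * I) ^ (n + 2)) * (-(t * I)) ^ n * I) (Ioo 0 1) := by
    intro t ht
    have ht0 : (t : ℂ) ≠ 0 := by exact_mod_cast ht.1.ne'
    have hI : (I : ℂ) ^ (n + 2) ≠ 0 := pow_ne_zero _ I_ne_zero
    have : P.f_modif t = ψ (t * I) - c / (t * I) ^ (n + 2) := by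
      rw [WeakFEPair.f_modif, Pi.add_apply, indicator_of_notMem (notMem_Ioi.mpr ht.2.le),
        indicator_of_mem ht, zero_add]
      change ψ (t * I) - ((I ^ (n + 2))⁻¹ * ((t ^ (-((n + 2 : ℕ) : ℝ)) : ℝ) : ℂ)) * c = _
      rw [Real.rpow_neg ht.1.le, Real.rpow_natCast]
      push_cast
      rw [mul_pow]
      field_simp
    simp only [this]
    rw [neg_mul_eq_mul_neg, mul_pow]
    ring
  have e1 : EqOn (fun t : ℝ ↦ (-I) ^ n * I * ((t : ℂ) ^ n * P.f_modif t))
      (fun t : ℝ ↦ (ψ (t * I) - a) * (-(t * I)) ^ n * I) (Ioi 1) := by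
    intro t ht
    have : P.f_modif t = ψ (t * I) - a := by
      rw [WeakFEPair.f_modif, Pi.add_apply, indicator_of_mem ht,
        indicator_of_notMem (notMem_Ioo_of_ge (le_of_lt ht)), add_zero]
      rfl
    simp only [this]
    rw [neg_mul_eq_mul_neg, mul_pow]
    ring
  refine ⟨?_, ?_⟩
  · rw [integrableOn_Ioc_iff_integrableOn_Ioo]
    exact (hc'.mono_set Ioo_subset_Ioi_self).congr_fun e0 measurableSet_Ioo
  · have hΛ : P.Λ₀ (n + 1) = ∫ t : ℝ in Ioi 0, (t : ℂ) ^ n * P.f_modif t := by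
      simp [WeakFEPair.Λ₀, mellin]
    rw [hΛ, ← integral_const_mul, ← Ioc_union_Ioi_eq_Ioi zero_le_one,
      setIntegral_union (Ioc_disjoint_Ioi le_rfl) measurableSet_Ioi
        (hc'.mono_set Ioc_subset_Ioi_self) (hc'.mono_set (Ioi_subset_Ioi zero_le_one)),
      setIntegral_congr_fun measurableSet_Ioi e1, integral_Ioc_eq_integral_Ioo,
      setIntegral_congr_fun measurableSet_Ioo e0, integral_Ioc_eq_integral_Ioo]

lemma integral_div_pow_mul_pow (c : ℂ) (n : ℕ) {ζ : ℂ} (hζ : 0 < ζ.im) :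
    ∫ t in (0 : ℝ)..1, c / (ζ + t * I) ^ (n + 2) * (-(t * I)) ^ n * I =
      (-I) ^ n * I * (c / ((n + 1) * ζ * (ζ + I) ^ (n + 1))) := by
  have hne : ∀ t : ℝ, t ∈ uIcc (0 : ℝ) 1 → ζ + t * I ≠ 0 := fun t ht ↦ by
    rw [uIcc_of_le zero_le_one] at ht
    refine ne_zero_of_im_pos ?_
    simp
    linarith [ht.1]
  have hζ0 := ne_zero_of_im_pos hζ
  have hn : (n + 1 : ℂ) ≠ 0 := by exact_mod_cast n.succ_ne_zero
  -- The derivative of `t / (ζ + it)` is `ζ / (ζ + it)^2`, so its power `n + 1` is a primitive up to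
  -- the factor `(n + 1) ζ`.
  rw [intervalIntegral.integral_eq_sub_of_hasDerivAt (f := fun t : ℝ ↦
    (-I) ^ n * I * (c / ((n + 1) * ζ)) * (t / (ζ + t * I)) ^ (n + 1))]
  · simp
    field_simp
  · intro t ht
    have h0 := hne t ht
    have h1 : HasDerivAt (fun t : ℝ ↦ (t : ℂ) / (ζ + t * I))
        ((1 * (ζ + t * I) - t * (1 * I)) / (ζ + t * I) ^ 2) t :=
      (hasDerivAt_id (t : ℂ)).comp_ofReal.div
        ((((hasDerivAt_id (t : ℂ)).comp_ofReal).mul_const I).const_add ζ) h0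
    refine ((h1.pow (n + 1)).const_mul ((-I) ^ n * I * (c / ((n + 1) * ζ)))).congr_deriv ?_
    rw [neg_mul_eq_mul_neg, mul_pow, div_pow]
    push_cast
    field_simp
    ring
  · refine ContinuousOn.intervalIntegrable ?_
    have : ∀ t ∈ uIcc (0 : ℝ) 1, (ζ + t * I) ^ (n + 2) ≠ 0 := fun t ht ↦ pow_ne_zero _ (hne t ht)
    fun_prop (disch := assumption)

lemma integral_const_mul_pow (a : ℂ) (n : ℕ) :
    ∫ t in (0 : ℝ)..1, a * (-(t * I)) ^ n * I = (-I) ^ n * I * (a / (n + 1)) := by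
  have : ∀ t : ℝ, a * (-(t * I)) ^ n * I = a * (-I) ^ n * I * ((t ^ n : ℝ) : ℂ) := fun t ↦ by
    rw [neg_mul_eq_mul_neg, mul_pow]
    push_cast
    ring
  simp only [this, intervalIntegral.integral_const_mul, intervalIntegral.integral_ofReal,
    integral_pow]
  push_cast
  simp
  ring

/-- First-order Taylor expansion of `(ζ + I)^{-(n+1)}` at `0`, divided by `(n + 1) ζ`. The
difference is a multiple of `dslope u 0 ζ - dslope u 0 0`, and `dslope u 0` is differentiable at
`0`. -/
lemma isBigO_pole_part (n : ℕ) :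
    (fun ζ : ℂ ↦ 1 / ((n + 1) * ζ * (ζ + I) ^ (n + 1)) - 1 / ((n + 1) * ζ * I ^ (n + 1)) +
      1 / I ^ (n + 2)) =O[𝓝[≠] 0] fun ζ ↦ ζ := by
  set u : ℂ → ℂ := fun ζ ↦ 1 / (ζ + I) ^ (n + 1) with hu
  have hn : (n + 1 : ℂ) ≠ 0 := by exact_mod_cast n.succ_ne_zero
  have hI : (I : ℂ) ≠ 0 := I_ne_zero
  have hball : ∀ z ∈ Metric.ball (0 : ℂ) 1, z + I ≠ 0 := fun z hz h0 ↦ by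
    rw [mem_ball_zero_iff, eq_neg_of_add_eq_zero_left h0] at hz
    simp at hz
  have hd : DifferentiableOn ℂ u (Metric.ball 0 1) := fun z hz ↦ by
    have := pow_ne_zero (n + 1) (hball z hz)
    refine DifferentiableAt.differentiableWithinAt ?_
    fun_prop (disch := assumption)
  have hmem : Metric.ball (0 : ℂ) 1 ∈ 𝓝 0 := Metric.ball_mem_nhds _ one_pos
  have hd' : DifferentiableAt ℂ (dslope u 0) 0 :=
    ((differentiableOn_dslope hmem).mpr hd 0 (Metric.mem_ball_self one_pos)).differentiableAt hmem
  have hu' : deriv u 0 = -(n + 1) / I ^ (n + 2) := by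
    have h1 : HasDerivAt (fun ζ : ℂ ↦ ζ + I) 1 0 := (hasDerivAt_id (0 : ℂ)).add_const I
    have h2 := ((h1.pow (n + 1)).inv (by simp)).deriv
    have h3 : u = ((fun ζ : ℂ ↦ ζ + I) ^ (n + 1))⁻¹ := by
      ext; simp [hu]
    rw [h3, h2]
    simp
    field_simp
    ring
  have := (hd'.isBigO_sub.mono nhdsWithin_le_nhds).const_mul_left (1 / (n + 1)) (l := 𝓝[≠] 0)
  refine this.congr' ?_ (by simp)
  filter_upwards [self_mem_nhdsWithin, nhdsWithin_le_nhds hmem] with ζ hζ hζb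
  have hζ0 : ζ ≠ 0 := hζ
  have h1 := hball ζ hζb
  rw [dslope_of_ne _ hζ0, dslope_same, hu', slope_def_field]
  simp only [hu, sub_zero, zero_add]
  field_simp
  ring

/-- The Eichler integral of a function with given constant terms at `i∞` and `0`. -/
noncomputable def eichler (ψ : ℂ → ℂ) (a : ℂ) (n : ℕ) (ζ : ℂ) : ℂ :=
  ∫ t : ℝ in Ioi 0, (ψ (ζ + t * I) - a) * (-(t * I)) ^ n * I

/-- For `ζ` in the upper half plane every piece is integrable separately, so on `(0, 1]` one may
trade `a` for `c / z^k` at the cost of two explicit integrals. -/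
lemma eichler_eq (h : HasCuspConstants ψ a c (n + 2)) {ζ : ℂ} (hζ : 0 < ζ.im) :
    IntegrableOn (fun t : ℝ ↦ (ψ (ζ + t * I) - c / (ζ + t * I) ^ (n + 2)) * (-(t * I)) ^ n * I)
      (Ioc 0 1) ∧
    eichler ψ a n ζ =
      (∫ t : ℝ in Ioc 0 1, (ψ (ζ + t * I) - c / (ζ + t * I) ^ (n + 2)) * (-(t * I)) ^ n * I) +
      (∫ t : ℝ in Ioi 1, (ψ (ζ + t * I) - a) * (-(t * I)) ^ n * I) +
      (-I) ^ n * I * (c / ((n + 1) * ζ * (ζ + I) ^ (n + 1)) - a / (n + 1)) := by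
  have hint := h.integrableOn_top n (ζ := ζ) (b := 0) (by simpa)
  have hne : ∀ t ∈ Icc (0 : ℝ) 1, (ζ + t * I) ^ (n + 2) ≠ 0 := fun t ht ↦ by
    refine pow_ne_zero _ (ne_zero_of_im_pos ?_)
    simp
    linarith [ht.1]
  have hcont := h.continuousOn_vertical (ζ := ζ) (s := Icc 0 1) (fun t ht ↦ by linarith [ht.1])
  have i1 : IntegrableOn
      (fun t : ℝ ↦ (ψ (ζ + t * I) - c / (ζ + t * I) ^ (n + 2)) * (-(t * I)) ^ n * I)
      (Ioc 0 1) := by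
    refine (ContinuousOn.integrableOn_Icc ?_).mono_set Ioc_subset_Icc_self
    exact ((hcont.sub (by fun_prop (disch := assumption))).mul (by fun_prop)).mul
      continuousOn_const
  have i2 : IntegrableOn (fun t : ℝ ↦ c / (ζ + t * I) ^ (n + 2) * (-(t * I)) ^ n * I)
      (Ioc 0 1) := by
    refine (ContinuousOn.integrableOn_Icc ?_).mono_set Ioc_subset_Icc_self
    fun_prop (disch := assumption)
  have i3 : IntegrableOn (fun t : ℝ ↦ a * (-(t * I)) ^ n * I) (Ioc 0 1) :=
    (ContinuousOn.integrableOn_Icc (by fun_prop)).mono_set Ioc_subset_Icc_self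
  refine ⟨i1, ?_⟩
  rw [eichler, ← Ioc_union_Ioi_eq_Ioi zero_le_one,
    setIntegral_union (Ioc_disjoint_Ioi le_rfl) measurableSet_Ioi
        (hint.mono_set Ioc_subset_Ioi_self) (hint.mono_set (Ioi_subset_Ioi zero_le_one)),
    mul_sub, ← integral_div_pow_mul_pow c n hζ, ← integral_const_mul_pow a n,
    intervalIntegral.integral_of_le zero_le_one, intervalIntegral.integral_of_le zero_le_one]
  have : ∫ t : ℝ in Ioc 0 1, (ψ (ζ + t * I) - a) * (-(t * I)) ^ n * I =
      (∫ t : ℝ in Ioc 0 1, (ψ (ζ + t * I) - c / (ζ + t * I) ^ (n + 2)) * (-(t * I)) ^ n * I) +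
      ((∫ t : ℝ in Ioc 0 1, c / (ζ + t * I) ^ (n + 2) * (-(t * I)) ^ n * I) -
      ∫ t : ℝ in Ioc 0 1, a * (-(t * I)) ^ n * I) := by
    rw [← integral_sub i2 i3]
    refine Eq.trans ?_ (integral_add i1 (i2.sub i3))
    refine integral_congr_ae (Eventually.of_forall fun t ↦ ?_)
    ring
  rw [this]
  ring

/-- Expansion of the Eichler integral in a sector with vertex `0`. -/
theorem eichler_isBigO (h : HasCuspConstants ψ a c (n + 2)) {C : ℝ} (hC : 0 < C) :
    (fun ζ ↦ eichler ψ a n ζ - ((-1) ^ n * c / ((n + 1) * ζ) +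
      (-I) ^ n * I * (h.weakFEPair (by simp)).Λ (n + 1)))
      =O[𝓝[{ζ : ℂ | 0 < ζ.im ∧ |ζ.re| ≤ C * ζ.im}] 0] fun ζ ↦ ζ := by
  set S := {ζ : ℂ | 0 < ζ.im ∧ |ζ.re| ≤ C * ζ.im}
  set P := h.weakFEPair (by simp)
  obtain ⟨K₀, hK₀, hlip₀⟩ := h.exists_lipschitz_sector hC
  obtain ⟨K₁, κ, hK₁, hκ, hlip₁⟩ := h.exists_lipschitz_top
  obtain ⟨j0, hΛ₀⟩ := h.mellin_f_modif_eq
  set B : ℂ → ℂ := fun ζ ↦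
    ∫ t : ℝ in Ioc 0 1, (ψ (ζ + t * I) - c / (ζ + t * I) ^ (n + 2)) * (-(t * I)) ^ n * I
  set A : ℂ → ℂ := fun ζ ↦ ∫ t : ℝ in Ioi 1, (ψ (ζ + t * I) - a) * (-(t * I)) ^ n * I
  have hsmall : ∀ᶠ ζ in 𝓝[S] (0 : ℂ), ‖ζ‖ ≤ 1 := by
    refine nhdsWithin_le_nhds ?_
    filter_upwards [Metric.closedBall_mem_nhds (0 : ℂ) one_pos] with ζ hζ
    simpa using hζ
  have hB : (fun ζ ↦ B ζ - B 0) =O[𝓝[S] 0] fun ζ ↦ ζ := by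
    refine IsBigO.of_bound K₀ ?_
    filter_upwards [self_mem_nhdsWithin, hsmall] with ζ hζ hζ1
    simp only [B, zero_add]
    rw [← integral_sub (h.eichler_eq hζ.1).1 j0]
    refine (norm_setIntegral_le_of_norm_le_const (C := K₀ * ‖ζ‖) (by simp) fun t ht ↦ ?_).trans
      (by simp)
    rw [← sub_mul, ← sub_mul, norm_mul, norm_mul]
    have h1 : ‖(-(t * I) : ℂ) ^ n‖ ≤ 1 := by
      rw [norm_pow]
      refine pow_le_one₀ (norm_nonneg _) ?_
      simp [abs_of_pos ht.1, ht.2]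
    have h2 := hlip₀ ζ hζ.1 hζ.2
      ((le_abs_self _).trans ((abs_im_le_norm ζ).trans hζ1)) t ht.1 ht.2
    calc _ ≤ K₀ * ‖ζ‖ * 1 * ‖I‖ := by gcongr
      _ = _ := by simp
  have hA : (fun ζ ↦ A ζ - A 0) =O[𝓝[S] 0] fun ζ ↦ ζ := by
    have hbint : IntegrableOn (fun t : ℝ ↦ K₁ * (t ^ (n : ℝ) * Real.exp (-κ * t))) (Ioi 1) :=
      Integrable.const_mul ((integrableOn_rpow_mul_exp_neg_mul_rpow (p := 1) (s := n) (b := κ)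
        (by have : (0 : ℝ) ≤ n := n.cast_nonneg
            linarith) one_pos hκ |>.congr_fun (fun t _ ↦ by simp) measurableSet_Ioi).mono_set
        (Ioi_subset_Ioi zero_le_one)) _
    refine IsBigO.of_bound (∫ t : ℝ in Ioi 1, K₁ * (t ^ (n : ℝ) * Real.exp (-κ * t))) ?_
    filter_upwards [self_mem_nhdsWithin, hsmall] with ζ hζ hζ1
    have j1 := h.integrableOn_top n (ζ := 0) (b := 1) (by simp)
    have j2 := h.integrableOn_top n (ζ := ζ) (b := 1) (by linarith [hζ.1])
    simp only [A]
    rw [← integral_sub j2 j1, ← integral_mul_const]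
    refine norm_integral_le_of_norm_le (hbint.mul_const _)
      ((ae_restrict_iff' measurableSet_Ioi).mpr (Eventually.of_forall fun t ht ↦ ?_))
    have ht0 : (0 : ℝ) < t := one_pos.trans ht
    rw [← sub_mul, ← sub_mul, norm_mul, norm_mul, zero_add]
    calc _ ≤ K₁ * Real.exp (-κ * t) * ‖ζ‖ * ‖(-(t * I) : ℂ) ^ n‖ * ‖I‖ := by
          gcongr
          exact hlip₁ ζ hζ.1 hζ1 t (le_of_lt ht)
      _ = _ := by
          simp [abs_of_pos ht0]
          ring
  have hpole := ((isBigO_pole_part n).const_mul_left ((-I) ^ n * I * c)).mono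
    (nhdsWithin_mono (0 : ℂ) (s := S) fun ζ hζ ↦ ne_zero_of_im_pos hζ.1)
  refine ((hB.add hA).add hpole).congr' ?_ EventuallyEq.rfl
  filter_upwards [self_mem_nhdsWithin] with ζ hζ
  -- At `s = n + 1 = k - 1` the polar denominator `k - s` is `1`. The term in `a` matches the one in
  -- `eichler_eq`, and the term in `c` is the constant in `isBigO_pole_part`.
  have hΛ : P.Λ (n + 1) = P.Λ₀ (n + 1) - a / (n + 1) - c / I ^ (n + 2) := by
    change P.Λ₀ (n + 1) - (1 / ((n : ℂ) + 1)) * a -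
      ((I ^ (n + 2))⁻¹ / (((n + 2 : ℕ) : ℝ) - (n + 1))) * c = _
    have : (((n + 2 : ℕ) : ℝ) : ℂ) - (n + 1) = 1 := by
      push_cast
      ring
    rw [this]
    ring
  have hsum : (-I) ^ n * I * P.Λ₀ (n + 1) = B 0 + A 0 := by
    rw [hΛ₀]
    simp [A, B]
  rw [(h.eichler_eq hζ.1).2, hΛ]
  have hsgn : ((-1) ^ n : ℂ) = (-I) ^ n * I / I ^ (n + 1) := by
    rw [neg_pow I, pow_succ I n]
    field_simp [pow_ne_zero n I_ne_zero]
  rw [hsgn]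
  rw [← div_div 1 ((n + 1) * ζ) (I ^ (n + 1))]
  linear_combination hsum

end HasCuspConstants

/-! ### Cusp constants of modular forms for `Γ(N)` -/

section ModularForms

open UpperHalfPlane hiding I
open Complex hiding Gamma
open Matrix.SpecialLinearGroup hiding map
open Filter Topology Asymptotics CongruenceSubgroup

/-- A modular form for `Γ`, seen as a modular form for a subgroup of `Γ`. -/
noncomputable def ModularForm.restrictSubgroup {Γ Γ' : Subgroup (GL (Fin 2) ℝ)} (hle : Γ' ≤ Γ)
    {k : ℤ} (f : ModularForm Γ k) : ModularForm Γ' k where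
  toFun := f
  slash_action_eq' γ hγ := f.slash_action_eq' γ (hle hγ)
  holo' := f.holo'
  bdd_at_cusps' hc := f.bdd_at_cusps' (hc.mono hle)

lemma natCast_mem_strictPeriods_Gamma (N : ℕ) :
    (N : ℝ) ∈ ((Gamma N).map (mapGL ℝ)).strictPeriods := by
  rw [strictPeriods_Gamma]
  exact AddSubgroup.mem_zmultiples _

open ConjAct Pointwise in
lemma conj_Gamma_map_eq (N : ℕ) (δ : SL(2, ℤ)) :
    toConjAct (mapGL ℝ δ)⁻¹ • (Gamma N).map (mapGL ℝ) = (Gamma N).map (mapGL ℝ) := by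
  have h := Gamma_cong_eq_self N (toConjAct δ⁻¹)
  conv_rhs => rw [← h]
  ext g
  simp only [Subgroup.mem_smul_pointwise_iff_exists, Subgroup.mem_map]
  constructor
  · rintro ⟨_, ⟨s, hs, rfl⟩, rfl⟩
    exact ⟨_, ⟨s, hs, rfl⟩, by rw [toConjAct_smul, toConjAct_smul]; simp⟩
  · rintro ⟨_, ⟨s, hs, rfl⟩, rfl⟩
    exact ⟨_, ⟨s, hs, rfl⟩, by rw [toConjAct_smul, toConjAct_smul]; simp⟩

/-- The group `Γ(N)` is normal, so `SL₂(ℤ)` acts on the modular forms for `Γ(N)`. -/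
lemma exists_modularForm_eq_slash {N k : ℕ} (f : ModularForm ((Gamma N).map (mapGL ℝ)) (k : ℤ))
    (δ : SL(2, ℤ)) :
    ∃ g : ModularForm ((Gamma N).map (mapGL ℝ)) (k : ℤ), ⇑g = ⇑f ∣[(k : ℤ)] δ :=
  ⟨(ModularForm.translate f (mapGL ℝ δ)).restrictSubgroup (conj_Gamma_map_eq N δ).ge, rfl⟩

variable {N k : ℕ} [NeZero N] (f : ModularForm ((Gamma N).map (mapGL ℝ)) (k : ℤ))

lemma modularForm_exp_decay :
    (fun τ ↦ f τ - valueAtInfty f) =O[atImInfty]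
      fun τ : ℍ ↦ Function.Periodic.qParam (N : ℝ) (τ : ℂ) := by
  have h := exp_decay_sub_atImInfty (h := (N : ℝ)) (f := f)
    (by exact_mod_cast Nat.pos_of_neZero N)
    (SlashInvariantFormClass.periodic_comp_ofComplex f (natCast_mem_strictPeriods_Gamma N))
    (ModularFormClass.holo f) (ModularFormClass.bdd_at_infty f)
  refine h.trans (IsBigO.of_bound 1 (Eventually.of_forall fun τ ↦ ?_))
  rw [one_mul, Function.Periodic.norm_qParam, Real.norm_of_nonneg (Real.exp_pos _).le]
  simp

lemma exists_isCuspConstant (x : ℚ) : ∃ a, IsCuspConstant f k x a := by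
  have hcop : IsCoprime x.num (x.den : ℤ) := Rat.isCoprime_num_den x
  obtain ⟨δ, h0, h1⟩ := hcop.exists_SL2_col 0
  obtain ⟨g, hg⟩ := exists_modularForm_eq_slash f δ
  refine ⟨valueAtInfty g, δ, h0, h1, N, Nat.pos_of_neZero N, ?_⟩
  rw [← hg]
  exact modularForm_exp_decay g

lemma isCuspConstant_cuspConstant (x : ℚ) : IsCuspConstant f k x (cuspConstant f k x) :=
  Classical.epsilon_spec (exists_isCuspConstant f x)

lemma modFourierCoeff_zero : modFourierCoeff f N 0 = valueAtInfty f := by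
  have hN : (0 : ℝ) < N := by exact_mod_cast Nat.pos_of_neZero N
  exact UpperHalfPlane.qExpansion_coeff_zero hN
    (ModularFormClass.analyticAt_cuspFunction_zero f hN (natCast_mem_strictPeriods_Gamma N))
    (SlashInvariantFormClass.periodic_comp_ofComplex f (natCast_mem_strictPeriods_Gamma N))

lemma modFourierCoeff_isBigO :
    modFourierCoeff f N =O[atTop] fun n : ℕ ↦ (n : ℝ) ^ (k : ℝ) := by
  have h := ModularFormClass.qExpansion_isBigO (by simp) f
  rw [strictWidthInfty_Gamma] at h
  simpa [funext_iff, modFourierCoeff, Function.comp_def] using! h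

lemma twistedCoeff_isBigO (x : ℚ) :
    twistedCoeff f N x =O[atTop] fun n : ℕ ↦ (n : ℝ) ^ (k : ℝ) := by
  refine IsBigO.trans (IsBigO.of_bound 1 (Eventually.of_forall fun n ↦ ?_))
    (modFourierCoeff_isBigO f)
  rw [twistedCoeff, norm_mul, one_mul]
  have : (2 * Real.pi * I * (n * x / N) : ℂ) = ((2 * Real.pi * (n * x / N) : ℝ) : ℂ) * I := by
    push_cast
    ring
  rw [this, norm_exp_ofReal_mul_I, mul_one]

lemma abscissaOfAbsConv_twistedCoeff_lt_top (x : ℚ) :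
    LSeries.abscissaOfAbsConv (twistedCoeff f N x) < ⊤ :=
  (LSeries.abscissaOfAbsConv_le_of_isBigO_rpow (twistedCoeff_isBigO f x)).trans_lt
    (by exact_mod_cast EReal.coe_lt_top _)

lemma expDecaysTo_of_isBigO_qParam {F : ℍ → ℂ} {a : ℂ} {M : ℕ} (hM : 0 < M)
    (h : (fun τ ↦ F τ - a) =O[atImInfty]
      fun τ : ℍ ↦ Function.Periodic.qParam (M : ℝ) (τ : ℂ)) :
    ExpDecaysTo (F ∘ ofComplex) a := by
  obtain ⟨K, hK⟩ := h.bound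
  obtain ⟨A, hA⟩ := (atImInfty_mem _).mp hK
  refine ⟨A, K, 2 * Real.pi / M, by positivity, fun z hz hzA ↦ ?_⟩
  have := hA ⟨z, hz⟩ hzA
  rw [Set.mem_ofPred_eq, Function.Periodic.norm_qParam] at this
  rw [Function.comp_apply, ofComplex_apply_of_im_pos hz]
  convert this using 3
  ring

lemma ExpDecaysTo.comp_affine {ψ : ℂ → ℂ} {a : ℂ} (h : ExpDecaysTo ψ a) {α : ℝ} (hα : 0 < α)
    (β : ℝ) (m : ℂ) : ExpDecaysTo (fun w ↦ m * ψ (α * w + β)) (m * a) := by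
  obtain ⟨A, K, κ, hκ, hA⟩ := h
  refine ⟨A / α, ‖m‖ * K, κ * α, by positivity, fun z hz hzA ↦ ?_⟩
  have him : (α * z + β : ℂ).im = α * z.im := by simp
  have := hA (α * z + β) (by rw [him]; positivity)
    (by rw [him]; rw [div_le_iff₀ hα] at hzA; linarith)
  rw [him] at this
  rw [← mul_sub, norm_mul, mul_assoc]
  calc _ ≤ ‖m‖ * _ := mul_le_mul_of_nonneg_left this (norm_nonneg _)
    _ = _ := by ring_nf

lemma ExpDecaysTo.congr {ψ φ : ℂ → ℂ} {a : ℂ} (h : ExpDecaysTo ψ a)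
    (hφ : ∀ z : ℂ, 0 < z.im → φ z = ψ z) : ExpDecaysTo φ a := by
  obtain ⟨A, K, κ, hκ, hA⟩ := h
  exact ⟨A, K, κ, hκ, fun z hz hzA ↦ by rw [hφ z hz]; exact hA z hz hzA⟩

/-- With `p = x.den`, `d = δ 1 1` and `w' = w/p² - d/p`, one has `p w' + d = w/p` and `δ w' = x -
1/w`. Thus inversion at `x` is the slash by `δ` after a real affine change of variable, which
preserves exponential decay. -/
lemma invertCusp_eq_slash (F : ℍ → ℂ) (k : ℕ) (x : ℚ) {δ : SL(2, ℤ)} (h0 : δ 0 0 = x.num)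
    (h1 : δ 1 0 = x.den) {w : ℂ} (hw : 0 < w.im) :
    invertCusp (fun ζ ↦ F (ofComplex (x + ζ))) k w =
      (-1) ^ k / (x.den : ℂ) ^ k * ((F ∣[(k : ℤ)] δ) ∘ ofComplex)
        ((((x.den : ℝ) ^ 2)⁻¹ : ℝ) * w + (-(δ 1 1 : ℝ) / x.den : ℝ)) := by
  have hp : (x.den : ℂ) ≠ 0 := by exact_mod_cast x.den_ne_zero
  have hp' : (0 : ℝ) < x.den := by exact_mod_cast x.den_pos
  have hw0 : w ≠ 0 := HasCuspConstants.ne_zero_of_im_pos hw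
  have hdet : (x.num : ℂ) * δ 1 1 - δ 0 1 * x.den = 1 := by
    have := δ.det_coe
    rw [Matrix.det_fin_two, h0, h1] at this
    exact_mod_cast this
  set w' : ℂ := (((x.den : ℝ) ^ 2)⁻¹ : ℝ) * w + (-(δ 1 1 : ℝ) / x.den : ℝ) with hw'
  have hwpos : 0 < w'.im := by
    simp only [hw', add_im, mul_im, ofReal_re, ofReal_im, zero_mul, add_zero]
    positivity
  have hden : (x.den : ℂ) * w' + δ 1 1 = w / x.den := by
    rw [hw']
    push_cast
    field_simp
    ring
  have hsmul : ((δ • (⟨w', hwpos⟩ : ℍ) : ℍ) : ℂ) = x + -1 / w := by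
    rw [coe_specialLinearGroup_apply, h0, h1]
    simp only [algebraMap_int_eq, eq_intCast, ofReal_intCast, Int.cast_natCast, ofReal_natCast]
    rw [hden, hw']
    have hx : (x : ℂ) = x.num / x.den := by exact_mod_cast (Rat.num_div_den x).symm
    rw [hx]
    push_cast
    field_simp
    linear_combination (-(x.den : ℂ)) * hdet
  rw [invertCusp, Function.comp_apply, ofComplex_apply_of_im_pos hwpos, ModularForm.SL_slash_apply,
    ← hsmul, ofComplex_apply]
  have hdenom : denom (toGL ((Matrix.SpecialLinearGroup.map (Int.castRingHom ℝ)) δ)) w' = w / x.den := by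
    rw [← hden]
    simp [denom, h1]
  rw [hdenom, zpow_neg, zpow_natCast, div_pow, div_pow]
  field_simp

/-- The translate of a modular form that moves the cusp `x` to `0` has the constant terms
`a₀` at `i∞` and `(-1)^k p^{-k} a₀^{(x)}` at `0`. -/
lemma hasCuspConstants (x : ℚ) :
    HasCuspConstants (fun ζ ↦ f (ofComplex (x + ζ))) (modFourierCoeff f N 0)
      ((-1) ^ k / (x.den : ℂ) ^ k * cuspConstant f k x) k where
  differentiableOn := by
    have h := UpperHalfPlane.mdifferentiable_iff.mp (ModularFormClass.holo f)
    exact h.comp (f := fun ζ : ℂ ↦ (x : ℂ) + ζ) (by fun_prop) fun z hz ↦ by simpa using hz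
  top := by
    have h := (expDecaysTo_of_isBigO_qParam (Nat.pos_of_neZero N)
      (modularForm_exp_decay f)).comp_affine one_pos x 1
    rw [modFourierCoeff_zero]
    simpa [add_comm] using h
  zero := by
    obtain ⟨δ, h0, h1, M, hM, hO⟩ := isCuspConstant_cuspConstant f x
    have hp' : (0 : ℝ) < x.den := by exact_mod_cast x.den_pos
    exact ((expDecaysTo_of_isBigO_qParam hM hO).comp_affine (α := ((x.den : ℝ) ^ 2)⁻¹)
      (by positivity) (-(δ 1 1 : ℝ) / x.den) _).congr fun w hw ↦ invertCusp_eq_slash f k x h0 h1 hw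

end ModularForms

/-! ### Identification with the completed twisted L-function -/

section CompletedTwistedL

open UpperHalfPlane hiding I
open Complex hiding Gamma
open Matrix.SpecialLinearGroup hiding map
open Filter Topology Asymptotics CongruenceSubgroup

/-- The plane minus two points is connected, and both functions agree with the Dirichlet series on a
half plane, so the identity theorem applies. -/
lemma IsCompletedTwistedL.eqOn {f : ℍ → ℂ} {N k : ℕ} {x : ℚ} {F G : ℂ → ℂ}
    (hF : IsCompletedTwistedL f N k x F) (hG : IsCompletedTwistedL f N k x G) :
    Set.EqOn F G {0, (k : ℂ)}ᶜ := by
  have hopen : IsOpen ({0, (k : ℂ)}ᶜ : Set ℂ) := (Set.toFinite _).isClosed.isOpen_compl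
  have hconn : IsPreconnected ({0, (k : ℂ)}ᶜ : Set ℂ) :=
    (Set.Countable.isPathConnected_compl_of_one_lt_rank (by simp [Complex.rank_real_complex])
      (Set.toFinite _).countable).isConnected.isPreconnected
  obtain ⟨σ, hσ, -⟩ := EReal.lt_iff_exists_real_btwn.mp hF.2.1
  set s₀ : ℝ := max σ (k : ℝ) + 1
  have h1 : σ < s₀ := (le_max_left _ _).trans_lt (lt_add_one _)
  have h2 : (k : ℝ) < s₀ := (le_max_right _ _).trans_lt (lt_add_one _)
  refine (hF.1.analyticOnNhd hopen).eqOn_of_preconnected_of_eventuallyEq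
    (hG.1.analyticOnNhd hopen) hconn (z₀ := (s₀ : ℂ)) ?_ ?_
  · have h3 : (0 : ℝ) < s₀ := (Nat.cast_nonneg k).trans_lt h2
    simp only [Set.mem_compl_iff, Set.mem_insert_iff, Set.mem_singleton_iff, not_or]
    exact ⟨by exact_mod_cast h3.ne', by exact_mod_cast h2.ne'⟩
  · have hU : {s : ℂ | σ < s.re ∧ (k : ℝ) < s.re} ∈ 𝓝 (s₀ : ℂ) :=
      ((isOpen_lt continuous_const Complex.continuous_re).inter
        (isOpen_lt continuous_const Complex.continuous_re)).mem_nhds (by simpa using ⟨h1, h2⟩)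
    filter_upwards [hU] with s hs
    have hs' := hσ.trans (EReal.coe_lt_coe_iff.mpr hs.1)
    rw [hF.2.2 s hs.2 hs', hG.2.2 s hs.2 hs']

variable {N k : ℕ} [NeZero N] (f : ModularForm ((Gamma N).map (mapGL ℝ)) (k : ℤ))

lemma hasSum_vertical (x : ℚ) {t : ℝ} (ht : 0 < t) :
    HasSum (fun n : ℕ ↦ (if n = 0 then 0 else twistedCoeff f N x n) *
      (Real.exp (-(2 * Real.pi * n / N) * t) : ℂ))
      (f (ofComplex (x + t * I)) - modFourierCoeff f N 0) := by
  have hN : (0 : ℝ) < N := by exact_mod_cast Nat.pos_of_neZero N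
  have hN' : (N : ℂ) ≠ 0 := by exact_mod_cast NeZero.ne N
  have h := ModularForm.hasSum_qExpansion f hN (natCast_mem_strictPeriods_Gamma N)
    (ofComplex (x + t * I))
  have h' := hasSum_ite_sub_hasSum h 0
  have him : 0 < (x + t * I : ℂ).im := by simpa using ht
  convert! h' using 2 with n
  · split_ifs with hn
    · simp
    · rw [twistedCoeff, modFourierCoeff, mul_assoc, ofComplex_apply_of_im_pos him]
      simp only [Function.Periodic.qParam]
      rw [← exp_nat_mul, ofReal_exp, ← exp_add]
      congr 2
      push_cast
      field_simp
      linear_combination (-(t : ℂ)) * I_sq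
  · simp [modFourierCoeff]

/-- Termwise Mellin transform of the Fourier expansion along the vertical line over `x`; for `Re s >
k` the function `Λ` is the plain Mellin transform of `f - f₀`. -/
lemma Λ_eq_twistedLSeries (hk : 0 < k) (x : ℚ) {s : ℂ} (hs : (k : ℝ) < s.re)
    (hs' : LSeries.abscissaOfAbsConv (twistedCoeff f N x) < s.re) :
    ((hasCuspConstants f x).weakFEPair hk).Λ s =
      (2 * Real.pi : ℂ) ^ (-s) * Complex.Gamma s * twistedLSeries f N x s := by
  have hN : (0 : ℝ) < N := by exact_mod_cast Nat.pos_of_neZero N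
  have hpos : 0 < s.re := (Nat.cast_nonneg k).trans_lt hs
  have hs0 : s ≠ 0 := by
    rintro rfl
    simp at hpos
  have hsum := LSeriesSummable_of_abscissaOfAbsConv_lt_re hs'
  set P := (hasCuspConstants f x).weakFEPair hk
  have hterm : ∀ n : ℕ, (if n = 0 then 0 else twistedCoeff f N x n) /
      ((2 * Real.pi * n / N : ℝ) : ℂ) ^ s =
      (2 * Real.pi : ℂ) ^ (-s) * ((N : ℂ) ^ s * LSeries.term (twistedCoeff f N x) s n) := by
    intro n
    rcases eq_or_ne n 0 with rfl | hn
    · simp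
    · have hn' : (0 : ℝ) < n := by exact_mod_cast Nat.pos_of_ne_zero hn
      rw [if_neg hn, LSeries.term_of_ne_zero hn, div_eq_mul_inv (2 * Real.pi * n) (N : ℝ),
        ofReal_mul, mul_cpow_ofReal_nonneg (by positivity) (by positivity), ofReal_mul,
        mul_cpow_ofReal_nonneg (by positivity) (by positivity), ofReal_inv,
        inv_cpow _ _ (by rw [arg_ofReal_of_nonneg hN.le]; exact Real.pi_pos.ne), cpow_neg]
      push_cast
      have h1 : (2 * Real.pi : ℂ) ^ s ≠ 0 := by
        rw [Ne, cpow_eq_zero_iff]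
        simp [Real.pi_ne_zero]
      have h2 : (n : ℂ) ^ s ≠ 0 := by
        rw [Ne, cpow_eq_zero_iff]
        simp [hn]
      have h3 : (N : ℂ) ^ s ≠ 0 := by
        rw [Ne, cpow_eq_zero_iff]
        simp [NeZero.ne N]
      field_simp
  have hmellin := hasSum_mellin (a := fun n : ℕ ↦ if n = 0 then 0 else twistedCoeff f N x n)
    (p := fun n : ℕ ↦ 2 * Real.pi * n / N) (F := fun t ↦ P.f t - P.f₀) (s := s)
    (fun n ↦ by
      rcases eq_or_ne n 0 with rfl | hn
      · simp
      · have hn' : (0 : ℝ) < n := by exact_mod_cast Nat.pos_of_ne_zero hn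
        exact .inr (by positivity))
    hpos (fun t ht ↦ hasSum_vertical f x ht) (by
      refine ((hsum.mul_left ((2 * Real.pi : ℂ) ^ (-s) * (N : ℂ) ^ s)).norm).congr fun n ↦ ?_
      rw [mul_assoc, ← hterm, norm_div]
      rcases eq_or_ne n 0 with rfl | hn
      · simp
      · have hn' : (0 : ℝ) < n := by exact_mod_cast Nat.pos_of_ne_zero hn
        rw [norm_cpow_eq_rpow_re_of_pos (by positivity)])
  rw [← (P.hasMellin hs).2, ← hmellin.tsum_eq, twistedLSeries, LSeries, ← tsum_mul_left,
    ← tsum_mul_left]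
  refine tsum_congr fun n ↦ ?_
  rw [mul_div_assoc, hterm]
  ring

lemma isCompletedTwistedL_Λ (hk : 0 < k) (x : ℚ) :
    IsCompletedTwistedL f N k x fun s ↦ -Complex.exp (2 * Real.pi * I * (-s / 4)) *
      ((hasCuspConstants f x).weakFEPair hk).Λ s := by
  refine ⟨fun s hs ↦ ?_, abscissaOfAbsConv_twistedCoeff_lt_top f x, fun s hs hs' ↦ ?_⟩
  · simp only [Set.mem_compl_iff, Set.mem_insert_iff, Set.mem_singleton_iff, not_or] at hs
    have := ((hasCuspConstants f x).weakFEPair hk).differentiableAt_Λ (s := s) (.inl hs.1)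
      (.inl (by simpa [HasCuspConstants.weakFEPair] using hs.2))
    exact (DifferentiableAt.mul (by fun_prop) this).differentiableWithinAt
  · beta_reduce
    rw [Λ_eq_twistedLSeries f hk x hs hs']
    ring

lemma isCompletedTwistedL_completedTwistedL (hk : 0 < k) (x : ℚ) :
    IsCompletedTwistedL f N k x (completedTwistedL f N k x) :=
  Classical.epsilon_spec ⟨_, isCompletedTwistedL_Λ f hk x⟩

lemma generalizedDedekindSum_eq {n : ℕ}
    (f : ModularForm ((Gamma N).map (mapGL ℝ)) ((n + 2 : ℕ) : ℤ)) (x : ℚ) :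
    generalizedDedekindSum f N (n + 2) x =
      (-I) ^ n * I * ((hasCuspConstants f x).weakFEPair (by simp)).Λ (n + 1) := by
  have he : ((n + 2 : ℕ) : ℂ) - 1 = n + 1 := by
    push_cast
    ring
  have hmem : (n + 1 : ℂ) ∈ ({0, ((n + 2 : ℕ) : ℂ)}ᶜ : Set ℂ) := by
    simp only [Set.mem_compl_iff, Set.mem_insert_iff, Set.mem_singleton_iff, not_or]
    exact ⟨by exact_mod_cast n.succ_ne_zero, by exact_mod_cast (by simp)⟩
  have h := (isCompletedTwistedL_completedTwistedL f (by simp) x).eqOn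
    (isCompletedTwistedL_Λ f (by simp) x) hmem
  rw [generalizedDedekindSum, he, h]
  congr 1
  have : (2 * Real.pi * I * (-(n + 1) / 4) : ℂ) = ((n + 1 : ℕ) : ℂ) * (-Real.pi / 2 * I) := by
    push_cast
    ring
  -- The factor `-e^{-πi(n+1)/2} = -(-I)^{n+1}` equals `(-I)^n I`, the constant produced by `dz` and
  -- `(τ - z)^n` on the vertical line.
  rw [this, exp_nat_mul, exp_neg_pi_div_two_mul_I, pow_succ]
  ring

lemma eichlerIntegral_eq (F : ℍ → ℂ) (N n : ℕ) (x : ℚ) (τ : ℂ) :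
    eichlerIntegral F N (n + 2) τ = HasCuspConstants.eichler (fun ζ ↦ F (ofComplex (x + ζ)))
      (modFourierCoeff F N 0) n (τ - x) := by
  simp only [eichlerIntegral, HasCuspConstants.eichler, eichlerIntegrand, add_tsub_cancel_right]
  congr 1
  ext t
  ring_nf

end CompletedTwistedL

/-! ### Assembly of the theorem -/

theorem proposition3 (Γ : Subgroup SL(2, ℤ)) (N : ℕ) (hN : 0 < N)
    (hΓ : CongruenceSubgroup.Gamma N ≤ Γ) (k : ℕ) (hk : 2 ≤ k)
    (f : ModularForm (Γ.map (Matrix.SpecialLinearGroup.mapGL ℝ)) (k : ℤ)) (x : ℚ) :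
    -- the objects in the formula are well defined
    IsCuspConstant f k x (cuspConstant f k x) ∧
    IsCompletedTwistedL f N k x (completedTwistedL f N k x) ∧
    (∀ τ : ℂ, 0 < τ.im → MeasureTheory.IntegrableOn
      (fun t : ℝ => eichlerIntegrand f N k τ (τ + t * Complex.I) * Complex.I) (Set.Ioi 0)) ∧
    -- the expansion, in every sector with vertex `x`
    (∀ C : ℝ, 0 < C →
      (fun τ : ℂ => eichlerIntegral f N k τ -
          (eichlerPole f k x τ + generalizedDedekindSum f N k x))
        =O[nhdsWithin (x : ℂ) (stolzSector x C)] fun τ : ℂ => τ - (x : ℂ)) ∧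
    -- the Dedekind sum as a radial limit
    Filter.Tendsto
      (fun t : ℝ => eichlerIntegral f N k ((x : ℂ) + t * Complex.I) -
        eichlerPole f k x ((x : ℂ) + t * Complex.I))
      (nhdsWithin 0 (Set.Ioi 0)) (nhds (generalizedDedekindSum f N k x)) := by
  have : NeZero N := ⟨hN.ne'⟩
  obtain ⟨n, rfl⟩ := Nat.exists_eq_add_of_le' hk
  -- Passing to `Γ(N)` provides a normal subgroup, so slashing by `δ` stays within modular forms of
  -- the same level.
  obtain ⟨g, hg⟩ : ∃ g : ModularForm ((CongruenceSubgroup.Gamma N).map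
      (Matrix.SpecialLinearGroup.mapGL ℝ)) ((n + 2 : ℕ) : ℤ), ⇑g = f :=
    ⟨f.restrictSubgroup (Subgroup.map_mono hΓ), rfl⟩
  rw [← hg]
  have H := hasCuspConstants g x
  have hexp : ∀ C : ℝ, 0 < C →
      (fun τ : ℂ => eichlerIntegral g N (n + 2) τ -
          (eichlerPole g (n + 2) x τ + generalizedDedekindSum g N (n + 2) x))
        =O[nhdsWithin (x : ℂ) (stolzSector x C)] fun τ : ℂ => τ - (x : ℂ) := by
    intro C hC
    have hto : Filter.Tendsto (fun τ : ℂ ↦ τ - x) (nhdsWithin (x : ℂ) (stolzSector x C))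
        (nhdsWithin 0 {ζ : ℂ | 0 < ζ.im ∧ |ζ.re| ≤ C * ζ.im}) := by
      refine tendsto_nhdsWithin_iff.mpr ⟨?_, ?_⟩
      · have : ContinuousAt (fun τ : ℂ ↦ τ - x) x := by fun_prop
        simpa [ContinuousAt] using this.mono_left (nhdsWithin_le_nhds (s := stolzSector x C))
      · filter_upwards [self_mem_nhdsWithin] with τ hτ
        simpa [stolzSector] using hτ
    refine ((H.eichler_isBigO hC).comp_tendsto hto).congr' ?_ Filter.EventuallyEq.rfl
    filter_upwards with τ
    rw [eichlerIntegral_eq g N n x τ, generalizedDedekindSum_eq g x, Function.comp_apply]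
    congr 2
    -- The sign `(-1)^k` from inverting the cusp cancels the `(-1)^n` of the pole.
    have hs : ((-1 : ℂ) ^ n) * (-1) ^ (n + 2) = 1 := by
      rw [← pow_add, show n + (n + 2) = 2 * (n + 1) by ring, pow_mul]
      simp
    rw [eichlerPole]
    push_cast
    have e : (n : ℂ) + 2 - 1 = n + 1 := by ring
    rw [e, ← mul_assoc, mul_div_assoc', hs]
    simp only [div_eq_mul_inv, mul_inv]
    ring
  refine ⟨isCuspConstant_cuspConstant g x, isCompletedTwistedL_completedTwistedL g (by simp) x,
    fun τ hτ ↦ ?_, hexp, ?_⟩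
  · refine (H.integrableOn_top n (ζ := τ - x) (b := 0) (by simpa using hτ)).congr_fun
      (fun t _ ↦ ?_) measurableSet_Ioi
    simp only [eichlerIntegrand, add_tsub_cancel_right]
    ring_nf
  · have hto : Filter.Tendsto (fun t : ℝ ↦ (x : ℂ) + t * Complex.I) (nhdsWithin 0 (Set.Ioi 0))
        (nhdsWithin (x : ℂ) (stolzSector x 1)) := by
      refine tendsto_nhdsWithin_iff.mpr ⟨?_, ?_⟩
      · have : ContinuousAt (fun t : ℝ ↦ (x : ℂ) + t * Complex.I) 0 := by fun_prop
        simpa [ContinuousAt] using this.mono_left (nhdsWithin_le_nhds (s := Set.Ioi 0))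
      · filter_upwards [self_mem_nhdsWithin] with t ht
        have ht' : 0 < t := ht
        simp [stolzSector, ht', ht'.le]
    have h0 : Filter.Tendsto (fun τ : ℂ ↦ τ - x) (nhdsWithin (x : ℂ) (stolzSector x 1))
        (nhds 0) := by
      have : ContinuousAt (fun τ : ℂ ↦ τ - x) x := by fun_prop
      simpa [ContinuousAt] using this.mono_left (nhdsWithin_le_nhds (s := stolzSector x 1))
    have h1 := ((hexp 1 one_pos).trans_tendsto h0).comp hto
    have h2 := h1.add_const (generalizedDedekindSum g N (n + 2) x)
    rw [zero_add] at h2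
    refine h2.congr fun t ↦ ?_
    simp only [Function.comp_apply]
    ring
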